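/- Let $V$ be a Euclidean space and $\Phi\subseteq V$ a (reduced, crystallographic) root system of type $D_4$ spanning $V$, with simple roots $\alpha_1,\alpha_2,\alpha_3,\alpha_4$ in Bourbaki's numbering (so $\alpha_2$ is the central node of the Dynkin diagram). Let $\alpha_0=\sum_i m_i\alpha_i$ be the highest root (a simple root $\alpha_j$ is called minuscule if $m_j=1$), and let $\varpi^\vee_1,\dots,\varpi^\vee_4\in V$ be the fundamental coweights, $(\varpi^\vee_i,\alpha_j)=\delta_{ij}$. Let $$\mathcal A=\{x\in V : (\alpha_i,x)\ge 0\ (1\le i\le 4),\ (\alpha_0,x)\le 1\}$$ be the fundamental alcove, $\mathrm{Aut}(\mathcal A)$ the group of rigid motions $g$ of $V$ with $g(\mathcal A)=\mathcal A$, and $$\mathcal K=\{x\in\mathcal A : (\alpha_0+\alpha_j,x)\le 1\ \text{for all minuscule } \alpha_j\}$$ the Komrakov--Premet polytope. Then $\mathrm{Aut}(\mathcal A)\cong S_4$, and $$\mathcal L'=\{x\in\mathcal K : (\alpha_3-\alpha_4,x)\ge 0,\ (\alpha_1-\alpha_3,x)\ge 0\}$$ is a fundamental polytope for the action of $\mathrm{Aut}(\mathcal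 A)$ on $\mathcal A$: it is a polytope (the convex hull of finitely many points), it is a closed connected subset of $\mathcal A$ that meets every $\mathrm{Aut}(\mathcal A)$-orbit in $\mathcal A$, and $g\mathcal L'\cap\mathcal L'$ has empty interior for every $g\in\mathrm{Aut}(\mathcal A)\setminus\{1\}$. Moreover, writing $\mathrm{vert}$ for the set of vertices (extreme points), $$\mathrm{vert}(\mathcal L')=\mathrm{vert}(\mathcal K)\cap\mathcal L'=\mathrm{vert}(\mathcal K)\setminus\left\{\frac{\varpi^\vee_3}{2},\ \frac{\varpi^\vee_4}{2},\ \frac{\varpi^\vee_1+\varpi^\vee_4}{3},\ \frac{\varpi^\vee_3+\varpi^\vee_4}{3}\right\}=\left\{0,\ \frac{\varpi^\vee_1}{2},\ \frac{\varpi^\vee_2}{2},\ \frac{\varpi^\vee_1+\varpi^\vee_3}{3},\ \frac{\varpi^\vee_1+\varpi^\vee_3+\varpi^\vee_4}{4}\right\}.$$ In particular $\mathrm{vert}(\mathcal K)$ is finite and $|\mathrm{vert}(\mathcal L')|=|\mathrm{vert}(\mathcal K)|-4$. -/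

import Mathlib

open scoped RealInnerProductSpace

/-! ### Euclidean root systems: highest root, fundamental coweights, alcove -/

namespace RootPairing

/-- A root pairing of the Euclidean space `V` with itself is Euclidean if roots and coroots are
paired by the inner product of `V` and the coroot of a root `α` is `α^∨ = 2 α / (α, α)`. In
particular its reflections are the orthogonal reflections in the root hyperplanes. -/
structure IsEuclidean {ι V : Type*} [NormedAddCommGroup V] [InnerProductSpace ℝ V]
    (P : RootPairing ι ℝ V V) : Prop where
  pairing_eq_inner : ∀ x y : V, P.toLinearMap x y = ⟪x, y⟫
  coroot_eq : ∀ i : ι, P.coroot i = (2 / ⟪P.root i, P.root i⟫) • P.root i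

namespace Base

variable {ι V : Type*} [NormedAddCommGroup V] [InnerProductSpace ℝ V] {P : RootPairing ι ℝ V V}

/-- `θ` is a highest root with respect to the base `b`: it is a root, and `θ - β` is a sum of
simple roots for every root `β`. -/
def IsHighestRoot (b : P.Base) (θ : V) : Prop :=
  θ ∈ Set.range P.root ∧ ∀ i : ι, θ - P.root i ∈ AddSubmonoid.closure (P.root '' b.support)

/-- The highest root `α₀` (which exists and is unique if the root system is irreducible). -/
noncomputable def highestRoot (b : P.Base) : V :=
  Classical.epsilon b.IsHighestRoot

/-- The coefficient `m_i` of the simple root `α_i` in the highest root, `α₀ = ∑ i, m_i • α_i`. -/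
noncomputable def mark [P.IsRootSystem] (b : P.Base) (i : b.support) : ℝ :=
  b.toWeightBasis.repr b.highestRoot i

/-- The simple root `α_j` is minuscule if its coefficient in the highest root is `1`. -/
def IsMinuscule [P.IsRootSystem] (b : P.Base) (j : b.support) : Prop :=
  b.mark j = 1

/-- The fundamental coweights: `ϖ^∨_i` is the vector of `V` that represents the `i`-th coordinate
functional of the basis of simple roots, that is, `(ϖ^∨_i, α_j) = δ_{ij}`. -/
noncomputable def fundCoweight [FiniteDimensional ℝ V] [P.IsRootSystem] (b : P.Base)
    (i : b.support) : V :=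
  (InnerProductSpace.toDual ℝ V).symm (LinearMap.toContinuousLinearMap (b.toWeightBasis.coord i))

theorem inner_fundCoweight_root [FiniteDimensional ℝ V] [P.IsRootSystem] [DecidableEq ι]
    (b : P.Base) (i j : b.support) :
    ⟪b.fundCoweight i, P.root j⟫ = if i = j then 1 else 0 := by
  rw [fundCoweight, InnerProductSpace.toDual_symm_apply]
  simp [Finsupp.single_apply, eq_comm]

/-- The closed fundamental alcove
`𝒜 = {x | (α_i, x) ≥ 0 for all simple roots α_i, and (α₀, x) ≤ 1}`. -/
def alcove (b : P.Base) : Set V :=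
  {x | (∀ i : b.support, 0 ≤ ⟪P.root i, x⟫) ∧ ⟪b.highestRoot, x⟫ ≤ 1}

/-- The Komrakov--Premet polytope
`𝒦 = {x ∈ 𝒜 | (α₀ + α_j, x) ≤ 1 for all minuscule α_j}`. -/
def komrakovPremet [P.IsRootSystem] (b : P.Base) : Set V :=
  {x ∈ b.alcove | ∀ j : b.support, b.IsMinuscule j → ⟪b.highestRoot + P.root j, x⟫ ≤ 1}

/-- The slice `{x ∈ 𝒦 | (v₀, x) ≥ 0, (v₁, x) ≥ 0}` of the Komrakov--Premet polytope. -/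
def slicedPolytope [P.IsRootSystem] (b : P.Base) (v₀ v₁ : V) : Set V :=
  {x ∈ b.komrakovPremet | 0 ≤ ⟪v₀, x⟫ ∧ 0 ≤ ⟪v₁, x⟫}

/-- The base `b` is of type `D₄`, with its simple roots numbered by `e` as in Bourbaki: `0, 1, 2, 3`
stand for `α₁, α₂, α₃, α₄`, and `α₂` is the central node of the Dynkin diagram. -/
def IsTypeD4 [P.IsCrystallographic] (b : P.Base) (e : Fin 4 ≃ b.support) : Prop :=
  ∀ i j : Fin 4, b.cartanMatrix (e i) (e j) = CartanMatrix.D 4 i j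

end Base

end RootPairing

/-! ### Symmetry groups, polytopes and fundamental polytopes -/

section Fundamental

variable {V : Type*} [NormedAddCommGroup V] [InnerProductSpace ℝ V]

/-- The group `Aut(X) = {g ∈ E(V) | g(X) = X}` of rigid motions of `V` that preserve `X`. -/
def rigidSymmetryGroup (X : Set V) : Subgroup (V ≃ᵃⁱ[ℝ] V) where
  carrier := {g | g '' X = X}
  mul_mem' {g h} hg hh := by
    rw [Set.mem_ofPred_eq] at hg hh ⊢
    rw [AffineIsometryEquiv.coe_mul, Set.image_comp, hh, hg]
  one_mem' := by simp
  inv_mem' {g} hg := by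
    rw [Set.mem_ofPred_eq] at hg ⊢
    conv_lhs => rw [← hg]
    rw [← Set.image_comp, ← AffineIsometryEquiv.coe_mul, inv_mul_cancel,
      AffineIsometryEquiv.coe_one, Set.image_id]

/-- `F` is a fundamental domain for the action of the group `G` of rigid motions on `X`: it is a
closed connected subset of `X` that meets every `G`-orbit in `X`, and `g F ∩ F` has empty interior
for every `g ≠ 1` in `G`. -/
structure IsFundDomainOn (G : Subgroup (V ≃ᵃⁱ[ℝ] V)) (X F : Set V) : Prop where
  subset : F ⊆ X
  isClosed : IsClosed F
  isConnected : IsConnected F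
  exists_mem : ∀ x ∈ X, ∃ g ∈ G, g x ∈ F
  interior_eq_empty : ∀ g ∈ G, g ≠ 1 → interior (g '' F ∩ F) = ∅

/-- A polytope is the convex hull of a finite set of points. -/
def IsConvexPolytope (F : Set V) : Prop :=
  ∃ s : Finset V, F = convexHull ℝ (s : Set V)

/-- A fundamental polytope is a fundamental domain that is a polytope. -/
def IsFundPolytopeOn (G : Subgroup (V ≃ᵃⁱ[ℝ] V)) (X F : Set V) : Prop :=
  IsFundDomainOn G X F ∧ IsConvexPolytope F

/-- The vertices of a polytope are its extreme points. -/
def polytopeVertices (F : Set V) : Set V :=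
  F.extremePoints ℝ

end Fundamental

/-! In type `D₄` the four outer nodes `-α₀, α₁, α₃, α₄` of the extended Dynkin diagram are pairwise
orthogonal and of equal length. They therefore give Cartesian coordinates `y₀ = ℓ(1 - (α₀,x))`, `y₁
= ℓ(α₁,x)`, `y₂ = ℓ(α₃,x)`, `y₃ = ℓ(α₄,x)` on `V`, with origin at `ϖ^∨₂/2`
(`IsTypeD4.exists_coordinates`). Since `α₀ = α₁ + 2α₂ + α₃ + α₄`, the coordinates add up to `ℓ -
2ℓ(α₂,x)`, and the alcove becomes the corner simplex `y ≥ 0`, `∑ yᵢ ≤ ℓ`. The inequalities of `𝒦`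
become `yⱼ ≤ y₀`, and those of `ℒ'` become `y₀ ≥ y₁ ≥ y₂ ≥ y₃`.

The theorem is now elementary. The rigid symmetries of the corner simplex are exactly the coordinate
permutations (`exists_eq_permCoords`), so the group is `S₄`, and sorting the coordinates shows that
the decreasing points form a fundamental domain. By Abel summation a sorted point is a convex
combination of the averaged vertices `(ℓ/|S|) 1_S` along a chain of initial segments `S`
(`mem_convexHull_of_antitone`). Hence the vertices are these points with `S = ∅` or `0 ∈ S` for `𝒦`
(nine of them), and with `S` an initial segment for `ℒ'` (five). -/

/-! ### Corner simplices and their symmetries -/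

section CornerSimplex

variable {κ : Type*} [Fintype κ]

/-- The corner simplex `{y | y i ≥ 0, ∑ i, y i ≤ ℓ}` of the positive orthant. -/
def cornerSimplex (κ : Type*) [Fintype κ] (ℓ : ℝ) : Set (EuclideanSpace ℝ κ) :=
  {y | (∀ i, 0 ≤ y i) ∧ ∑ i, y i ≤ ℓ}

theorem sum_sq_le_of_mem_cornerSimplex {ℓ : ℝ} {y : EuclideanSpace ℝ κ}
    (hy : y ∈ cornerSimplex κ ℓ) : ∑ i, y i ^ 2 ≤ ℓ ^ 2 := by
  have h0 : 0 ≤ ∑ i, y i := Finset.sum_nonneg fun i _ => hy.1 i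
  calc ∑ i, y i ^ 2 ≤ (∑ i, y i) ^ 2 :=
        Finset.sum_sq_le_sq_sum_of_nonneg fun i _ => hy.1 i
    _ ≤ ℓ ^ 2 := by gcongr; exact hy.2

theorem dist_sq_eq_sum (x y : EuclideanSpace ℝ κ) :
    dist x y ^ 2 = ∑ i, (x i - y i) ^ 2 := by
  rw [EuclideanSpace.dist_eq, Real.sq_sqrt (Finset.sum_nonneg fun i _ => by positivity)]
  exact Finset.sum_congr rfl fun i _ => by rw [Real.dist_eq, sq_abs]

/-- The rigid motion that permutes the coordinates. -/
noncomputable def permCoords (σ : Equiv.Perm κ) :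
    EuclideanSpace ℝ κ ≃ᵃⁱ[ℝ] EuclideanSpace ℝ κ :=
  (LinearIsometryEquiv.piLpCongrLeft 2 ℝ ℝ σ).toAffineIsometryEquiv

@[simp]
theorem permCoords_apply (σ : Equiv.Perm κ) (y : EuclideanSpace ℝ κ) (i : κ) :
    permCoords σ y i = y (σ.symm i) := by
  simp [permCoords, LinearIsometryEquiv.piLpCongrLeft_apply, Equiv.piCongrLeft'_apply]

theorem permCoords_mem_cornerSimplex (σ : Equiv.Perm κ) {ℓ : ℝ} {y : EuclideanSpace ℝ κ}
    (hy : y ∈ cornerSimplex κ ℓ) : permCoords σ y ∈ cornerSimplex κ ℓ := by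
  refine ⟨fun i => by simpa using hy.1 _, ?_⟩
  simp only [permCoords_apply]
  rw [Equiv.sum_comp σ.symm fun i => y i]
  exact hy.2

theorem permCoords_mul (σ τ : Equiv.Perm κ) :
    permCoords (σ * τ) = permCoords σ * permCoords τ := by
  ext y i
  simp [AffineIsometryEquiv.coe_mul]
  rfl

theorem permCoords_one : permCoords (1 : Equiv.Perm κ) = 1 := by
  ext y i
  simp [AffineIsometryEquiv.coe_one]
  rfl

theorem permCoords_mem_rigidSymmetryGroup (σ : Equiv.Perm κ) (ℓ : ℝ) :
    permCoords σ ∈ rigidSymmetryGroup (cornerSimplex κ ℓ) := by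
  refine Set.Subset.antisymm ?_ fun y hy => ?_
  · rintro _ ⟨y, hy, rfl⟩
    exact permCoords_mem_cornerSimplex σ hy
  · refine ⟨permCoords σ⁻¹ y, permCoords_mem_cornerSimplex _ hy, ?_⟩
    rw [← Function.comp_apply (f := permCoords σ), ← AffineIsometryEquiv.coe_mul,
      ← permCoords_mul, mul_inv_cancel, permCoords_one, AffineIsometryEquiv.coe_one, id]

variable [DecidableEq κ]

theorem single_mem_cornerSimplex {ℓ : ℝ} (hℓ : 0 < ℓ) (i : κ) :
    EuclideanSpace.single i ℓ ∈ cornerSimplex κ ℓ := by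
  refine ⟨fun j => ?_, ?_⟩
  · by_cases h : j = i <;> simp [h, hℓ.le]
  · simp

/-- A point of the corner simplex at maximal distance from the origin is a vertex. -/
theorem exists_eq_single_of_sum_sq_eq {ℓ : ℝ} (hℓ : 0 < ℓ) {y : EuclideanSpace ℝ κ}
    (hy : y ∈ cornerSimplex κ ℓ) (h : ∑ i, y i ^ 2 = ℓ ^ 2) :
    ∃ i, y = EuclideanSpace.single i ℓ := by
  have hle : ∀ i, y i ≤ ℓ := fun i =>
    (Finset.single_le_sum (fun j _ => hy.1 j) (Finset.mem_univ i)).trans hy.2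
  -- These nonnegative terms add up to `ℓ ∑ yᵢ - ∑ yᵢ² ≤ ℓ² - ℓ² = 0`, so every coordinate is `0` or
  -- `ℓ`.
  have hterm : ∀ i, 0 ≤ y i * (ℓ - y i) := fun i =>
    mul_nonneg (hy.1 i) (sub_nonneg.2 (hle i))
  have hexp : ∑ i, y i * (ℓ - y i) = ℓ * ∑ i, y i - ∑ i, y i ^ 2 := by
    rw [Finset.mul_sum, ← Finset.sum_sub_distrib]
    exact Finset.sum_congr rfl fun i _ => by ring
  have hsum : ∑ i, y i * (ℓ - y i) = 0 := by
    refine le_antisymm ?_ (Finset.sum_nonneg fun i _ => hterm i)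
    nlinarith [hy.2]
  have hS : ∑ i, y i = ℓ := by
    have : ℓ * ∑ i, y i = ℓ * ℓ := by nlinarith
    exact mul_left_cancel₀ hℓ.ne' this
  have hz := (Finset.sum_eq_zero_iff_of_nonneg fun i _ => hterm i).1 hsum
  obtain ⟨i, hi⟩ : ∃ i, y i ≠ 0 := by
    by_contra! hc
    simp [hc] at hS
    exact hℓ.ne hS
  have hi' : y i = ℓ := by
    have := (mul_eq_zero.1 (hz i (Finset.mem_univ i))).resolve_left hi
    linarith
  refine ⟨i, ?_⟩
  ext j
  by_cases hj : j = i
  · simp [hj, hi']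
  · have h1 := Finset.add_sum_erase Finset.univ (fun j => y j) (Finset.mem_univ i)
    have h2 : ∑ j ∈ Finset.univ.erase i, y j = 0 := by simp only at h1; linarith
    have h3 := (Finset.sum_eq_zero_iff_of_nonneg fun j _ => hy.1 j).1 h2 j (by simp [hj])
    simp [hj, h3]

/-- Both squared norms are at most `ℓ²` and the inner product is nonnegative, so `2ℓ²` is the
largest possible squared distance and forces `x` to have norm `ℓ`. This metric property singles out
the vertices other than the origin. -/
theorem exists_eq_single_of_dist_sq {ℓ : ℝ} (hℓ : 0 < ℓ) {x y : EuclideanSpace ℝ κ}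
    (hx : x ∈ cornerSimplex κ ℓ) (hy : y ∈ cornerSimplex κ ℓ) (h : dist x y ^ 2 = 2 * ℓ ^ 2) :
    ∃ i, x = EuclideanSpace.single i ℓ := by
  refine exists_eq_single_of_sum_sq_eq hℓ hx ?_
  have h1 := sum_sq_le_of_mem_cornerSimplex hx
  have h2 := sum_sq_le_of_mem_cornerSimplex hy
  have h3 : 0 ≤ ∑ i, x i * y i := Finset.sum_nonneg fun i _ => mul_nonneg (hx.1 i) (hy.1 i)
  have h4 : ∑ i, (x i - y i) ^ 2 = ∑ i, x i ^ 2 + ∑ i, y i ^ 2 - 2 * ∑ i, x i * y i := by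
    rw [Finset.mul_sum, ← Finset.sum_add_distrib, ← Finset.sum_sub_distrib]
    exact Finset.sum_congr rfl fun i _ => by ring
  rw [dist_sq_eq_sum, h4] at h
  linarith

theorem dist_sq_single_single {ℓ : ℝ} {i j : κ} (hij : i ≠ j) :
    dist (EuclideanSpace.single i ℓ : EuclideanSpace ℝ κ) (EuclideanSpace.single j ℓ) ^ 2
      = 2 * ℓ ^ 2 := by
  have h4 : ∀ k, ((EuclideanSpace.single i ℓ : EuclideanSpace ℝ κ) k -
      (EuclideanSpace.single j ℓ : EuclideanSpace ℝ κ) k) ^ 2 =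
      (if k = i then ℓ ^ 2 else 0) + (if k = j then ℓ ^ 2 else 0) := by
    intro k
    by_cases h1 : k = i
    · subst h1; simp [hij]
    · by_cases h2 : k = j
      · subst h2; simp [h1]
      · simp [h1, h2]
  rw [dist_sq_eq_sum, Finset.sum_congr rfl fun k _ => h4 k, Finset.sum_add_distrib]
  simp
  ring

theorem permCoords_injective : Function.Injective (permCoords (κ := κ)) := by
  intro σ τ h
  ext i
  have h1 := congrArg (fun g => g (EuclideanSpace.single i (1 : ℝ)) (σ i)) h
  simp only [permCoords_apply, Equiv.symm_apply_apply, PiLp.single_apply] at h1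
  have h2 : τ.symm (σ i) = i := by simpa using h1
  exact (Equiv.symm_apply_eq τ).1 h2

/-- The origin is the only point of the corner simplex at distance `ℓ` from the other vertices. -/
theorem eq_zero_of_dist_single_eq [Nontrivial κ] {ℓ : ℝ} (hℓ : 0 < ℓ)
    {z : EuclideanSpace ℝ κ} (hz : z ∈ cornerSimplex κ ℓ)
    (h : ∀ i, dist z (EuclideanSpace.single i ℓ) = ℓ) : z = 0 := by
  have h1 : ∀ i, ∑ j, z j ^ 2 = 2 * ℓ * z i := by
    intro i
    have h2 := dist_sq_eq_sum z (EuclideanSpace.single i ℓ)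
    have h3 : ∀ j, (z j - (EuclideanSpace.single i ℓ : EuclideanSpace ℝ κ) j) ^ 2 =
        z j ^ 2 + if j = i then ℓ ^ 2 - 2 * ℓ * z i else 0 := by
      intro j
      by_cases hj : j = i
      · subst hj; simp; ring
      · simp [hj]
    rw [h i, Finset.sum_congr rfl fun j _ => h3 j, Finset.sum_add_distrib] at h2
    simp at h2
    linarith
  obtain ⟨a, b, hab⟩ := exists_pair_ne κ
  have hc : ∀ i, z i = z a := fun i => by
    have := (h1 i).symm.trans (h1 a)
    exact mul_left_cancel₀ (by positivity) this
  -- All coordinates are equal; if they were nonzero, `h1` would make their sum `2ℓ`, beyond the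
  -- bound `ℓ`.
  have ha : z a = 0 := by
    by_contra hne
    have h5 := h1 a
    simp only [hc] at h5
    have h6 := hz.2
    simp only [hc] at h6
    simp at h5 h6
    have h7 : (Fintype.card κ : ℝ) * z a = 2 * ℓ :=
      mul_right_cancel₀ hne (by linarith)
    linarith
  ext i
  rw [hc, ha]; simp

/-- A symmetry preserves distances, so it permutes the vertices at mutual distance `√2 ℓ` and fixes
the origin, the only point at distance `ℓ` from all of them. It is thus linear and permutes a
rescaled standard basis. -/
theorem exists_eq_permCoords [Nontrivial κ] {ℓ : ℝ} (hℓ : 0 < ℓ)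
    {g : EuclideanSpace ℝ κ ≃ᵃⁱ[ℝ] EuclideanSpace ℝ κ}
    (hg : g ∈ rigidSymmetryGroup (cornerSimplex κ ℓ)) : ∃ σ, permCoords σ = g := by
  have hmem : ∀ y ∈ cornerSimplex κ ℓ, g y ∈ cornerSimplex κ ℓ := fun y hy => by
    have h : g '' cornerSimplex κ ℓ = cornerSimplex κ ℓ := hg
    rw [← h]; exact ⟨y, hy, rfl⟩
  have hv : ∀ i, ∃ j, g (EuclideanSpace.single i ℓ) = EuclideanSpace.single j ℓ := by
    intro i
    obtain ⟨k, hk⟩ := exists_ne i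
    refine exists_eq_single_of_dist_sq hℓ (hmem _ (single_mem_cornerSimplex hℓ i))
      (hmem _ (single_mem_cornerSimplex hℓ k)) ?_
    rw [g.dist_map, dist_sq_single_single hk.symm]
  choose f hf using hv
  have hinj : Function.Injective f := by
    intro i j hij
    have h1 := g.injective
      (by rw [hf i, hf j, hij] : g (EuclideanSpace.single i ℓ) = g (EuclideanSpace.single j ℓ))
    by_contra hne
    have h2 := congrArg (fun y : EuclideanSpace ℝ κ => y i) h1
    simp [hne] at h2
    exact hℓ.ne' h2
  have hbij : Function.Bijective f := Finite.injective_iff_bijective.1 hinj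
  have h0mem : (0 : EuclideanSpace ℝ κ) ∈ cornerSimplex κ ℓ := ⟨by simp, by simpa using hℓ.le⟩
  have h0 : g 0 = 0 := by
    refine eq_zero_of_dist_single_eq hℓ (hmem 0 h0mem) fun i => ?_
    obtain ⟨k, rfl⟩ := hbij.2 i
    rw [← hf k, g.dist_map, dist_zero_left]
    simp [abs_of_pos hℓ]
  refine ⟨Equiv.ofBijective f hbij, ?_⟩
  have hlin : ∀ v, g v = g.linearIsometryEquiv v := fun v => by
    have := g.map_vadd 0 v
    simpa [h0] using this
  have hL : (LinearIsometryEquiv.piLpCongrLeft 2 ℝ ℝ (Equiv.ofBijective f hbij)) =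
      g.linearIsometryEquiv := by
    refine LinearIsometryEquiv.toLinearEquiv_injective ?_
    refine LinearEquiv.toLinearMap_injective ?_
    refine (EuclideanSpace.basisFun κ ℝ).toBasis.ext fun i => ?_
    have hs : (EuclideanSpace.single i (1 : ℝ) : EuclideanSpace ℝ κ) =
        ℓ⁻¹ • EuclideanSpace.single i ℓ := by
      ext j; by_cases hj : j = i <;> simp [hj, hℓ.ne']
    have hs' : (EuclideanSpace.single (f i) (1 : ℝ) : EuclideanSpace ℝ κ) =
        ℓ⁻¹ • EuclideanSpace.single (f i) ℓ := by
      ext j; by_cases hj : j = f i <;> simp [hj, hℓ.ne']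
    simp only [OrthonormalBasis.coe_toBasis, EuclideanSpace.basisFun_apply,
      LinearEquiv.coe_coe, LinearIsometryEquiv.coe_toLinearEquiv]
    rw [EuclideanSpace.piLpCongrLeft_single, Equiv.ofBijective_apply, hs', hs, map_smul,
      ← hlin, hf]
  ext1 v
  rw [hlin, ← hL]
  rfl

/-- Permutation of the coordinates, as a homomorphism to the symmetries of the corner simplex. -/
noncomputable def permCoordsHom (κ : Type*) [Fintype κ] (ℓ : ℝ) :
    Equiv.Perm κ →* rigidSymmetryGroup (cornerSimplex κ ℓ) where
  toFun σ := ⟨permCoords σ, permCoords_mem_rigidSymmetryGroup σ ℓ⟩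
  map_one' := Subtype.ext permCoords_one
  map_mul' σ τ := Subtype.ext (permCoords_mul σ τ)

theorem permCoordsHom_bijective [Nontrivial κ] {ℓ : ℝ} (hℓ : 0 < ℓ) :
    Function.Bijective (permCoordsHom κ ℓ) :=
  ⟨fun _ _ h => permCoords_injective (congrArg Subtype.val h), fun g => by
    obtain ⟨σ, h⟩ := exists_eq_permCoords hℓ g.2
    exact ⟨σ, Subtype.ext h⟩⟩

end CornerSimplex

/-! ### Slices of the corner simplex in dimension four and their vertices -/

section CornerSlices

/-- The points of the corner simplex whose first coordinate is the largest one. -/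
def cornerMaxSlice (ℓ : ℝ) : Set (EuclideanSpace ℝ (Fin 4)) :=
  {y ∈ cornerSimplex (Fin 4) ℓ | ∀ i, y i ≤ y 0}

/-- The points of the corner simplex with decreasing coordinates. -/
def cornerSortedSlice (ℓ : ℝ) : Set (EuclideanSpace ℝ (Fin 4)) :=
  {y ∈ cornerSimplex (Fin 4) ℓ | Antitone fun i => y i}

/-- The point with coordinates `ℓ / |S|` on `S` and `0` elsewhere. -/
noncomputable def cornerVertex (ℓ : ℝ) (S : Finset (Fin 4)) : EuclideanSpace ℝ (Fin 4) :=
  WithLp.toLp 2 fun i => if i ∈ S then ℓ / S.card else 0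

@[simp]
theorem cornerVertex_apply (ℓ : ℝ) (S : Finset (Fin 4)) (i : Fin 4) :
    cornerVertex ℓ S i = if i ∈ S then ℓ / S.card else 0 := rfl

theorem cornerVertex_injective {ℓ : ℝ} (hℓ : 0 < ℓ) : Function.Injective (cornerVertex ℓ) := by
  intro S T h
  have key : ∀ S : Finset (Fin 4), ∀ i, i ∈ S ↔ cornerVertex ℓ S i ≠ 0 := by
    intro S i
    by_cases hi : i ∈ S
    · have : S.card ≠ 0 := Finset.card_ne_zero_of_mem hi
      simp [hi, hℓ.ne', this]
    · simp [hi]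
  ext i
  rw [key S, key T, h]

theorem cornerVertex_mem_cornerSimplex {ℓ : ℝ} (hℓ : 0 < ℓ) (S : Finset (Fin 4)) :
    cornerVertex ℓ S ∈ cornerSimplex (Fin 4) ℓ := by
  refine ⟨fun i => ?_, ?_⟩
  · rw [cornerVertex_apply]; split_ifs <;> positivity
  · simp only [cornerVertex_apply, Finset.sum_ite_mem, Finset.univ_inter, Finset.sum_const,
      nsmul_eq_mul]
    rcases eq_or_ne (S.card : ℝ) 0 with h | h
    · simp [h, hℓ.le]
    · exact (mul_div_cancel₀ ℓ h).le

/-- Supports of the vertices of `cornerMaxSlice`. -/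
def maxSupports : Finset (Finset (Fin 4)) :=
  Finset.univ.filter fun S => S = ∅ ∨ 0 ∈ S

/-- Supports of the vertices of `cornerSortedSlice`. -/
def sortedSupports : Finset (Finset (Fin 4)) :=
  {∅, {0}, {0, 1}, {0, 1, 2}, {0, 1, 2, 3}}

theorem sortedSupports_subset : sortedSupports ⊆ maxSupports := by decide

theorem cornerSortedSlice_subset (ℓ : ℝ) : cornerSortedSlice ℓ ⊆ cornerMaxSlice ℓ :=
  fun _ hy => ⟨hy.1, fun i => hy.2 (Fin.zero_le i)⟩

theorem cornerVertex_mem_cornerMaxSlice {ℓ : ℝ} (hℓ : 0 < ℓ) {S : Finset (Fin 4)}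
    (hS : S ∈ maxSupports) : cornerVertex ℓ S ∈ cornerMaxSlice ℓ := by
  refine ⟨cornerVertex_mem_cornerSimplex hℓ S, fun i => ?_⟩
  rcases (Finset.mem_filter.1 hS).2 with rfl | h
  · simp
  · simp only [cornerVertex_apply, h, if_true]
    split_ifs
    · exact le_rfl
    · positivity

theorem cornerVertex_mem_cornerSortedSlice {ℓ : ℝ} (hℓ : 0 < ℓ) {S : Finset (Fin 4)}
    (hS : S ∈ sortedSupports) : cornerVertex ℓ S ∈ cornerSortedSlice ℓ := by
  refine ⟨cornerVertex_mem_cornerSimplex hℓ S, fun i j hij => ?_⟩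
  have h : ∀ S ∈ sortedSupports, ∀ i j : Fin 4, i ≤ j → j ∈ S → i ∈ S := by decide
  simp only [cornerVertex_apply]
  by_cases hj : j ∈ S
  · simp [hj, h S hS i j hij hj]
  · rw [if_neg hj]
    split_ifs <;> positivity

theorem convex_cornerSimplex {κ : Type*} [Fintype κ] (ℓ : ℝ) : Convex ℝ (cornerSimplex κ ℓ) := by
  intro x hx y hy a b ha hb hab
  refine ⟨fun i => ?_, ?_⟩
  · have := mul_nonneg ha (hx.1 i)
    have := mul_nonneg hb (hy.1 i)
    simp; linarith
  · simp only [PiLp.add_apply, PiLp.smul_apply, smul_eq_mul, Finset.sum_add_distrib,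
      ← Finset.mul_sum]
    calc a * ∑ i, x i + b * ∑ i, y i ≤ a * ℓ + b * ℓ :=
          add_le_add (mul_le_mul_of_nonneg_left hx.2 ha) (mul_le_mul_of_nonneg_left hy.2 hb)
      _ = ℓ := by rw [← add_mul, hab, one_mul]

theorem convex_cornerSortedSlice (ℓ : ℝ) : Convex ℝ (cornerSortedSlice ℓ) := by
  intro x hx y hy a b ha hb hab
  refine ⟨convex_cornerSimplex ℓ hx.1 hy.1 ha hb hab, fun i j hij => ?_⟩
  have h1 := mul_le_mul_of_nonneg_left (hx.2 hij) ha
  have h2 := mul_le_mul_of_nonneg_left (hy.2 hij) hb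
  simpa using add_le_add h1 h2

theorem convex_cornerMaxSlice (ℓ : ℝ) : Convex ℝ (cornerMaxSlice ℓ) := by
  intro x hx y hy a b ha hb hab
  refine ⟨convex_cornerSimplex ℓ hx.1 hy.1 ha hb hab, fun i => ?_⟩
  have h1 := mul_le_mul_of_nonneg_left (hx.2 i) ha
  have h2 := mul_le_mul_of_nonneg_left (hy.2 i) hb
  simpa using add_le_add h1 h2

theorem isClosed_cornerSortedSlice (ℓ : ℝ) : IsClosed (cornerSortedSlice ℓ) := by
  have : cornerSortedSlice ℓ =
      ((⋂ i, {y | 0 ≤ y i}) ∩ {y | ∑ i, y i ≤ ℓ}) ∩ ⋂ i, ⋂ j, ⋂ _ : i ≤ j, {y | y j ≤ y i} := by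
    ext y
    simp [cornerSortedSlice, cornerSimplex, Antitone]
  rw [this]
  refine ((isClosed_iInter fun i => ?_).inter ?_).inter
    (isClosed_iInter fun i => isClosed_iInter fun j => isClosed_iInter fun _ => ?_)
  · exact isClosed_le (by fun_prop) (by fun_prop)
  · exact isClosed_le (by fun_prop) (by fun_prop)
  · exact isClosed_le (by fun_prop) (by fun_prop)

/-- A point of the corner simplex whose coordinates are sorted by `σ` is a convex combination of
the vertices that belong to the chain of initial segments of `σ`. -/
theorem mem_convexHull_of_antitone {ℓ : ℝ} (hℓ : 0 < ℓ) {y : EuclideanSpace ℝ (Fin 4)}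
    (hy : y ∈ cornerSimplex (Fin 4) ℓ) (σ : Equiv.Perm (Fin 4)) (hσ : Antitone fun i => y (σ i)) :
    y ∈ convexHull ℝ
      (cornerVertex ℓ '' (sortedSupports.image fun S => S.map σ.toEmbedding : Finset _)) := by
  set C := convexHull ℝ
      (cornerVertex ℓ '' (sortedSupports.image fun S => S.map σ.toEmbedding : Finset _))
  have hC : ∀ S ∈ sortedSupports, cornerVertex ℓ (S.map σ.toEmbedding) ∈ C := fun S hS =>
    subset_convexHull ℝ _ ⟨_, by exact_mod_cast Finset.mem_image_of_mem _ hS, rfl⟩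
  have hsum : ∑ i, y (σ i) ≤ ℓ := by
    rw [Equiv.sum_comp σ fun i => y i]; exact hy.2
  rw [Fin.sum_univ_four] at hsum
  have h01 : y (σ 1) ≤ y (σ 0) := hσ (by decide)
  have h12 : y (σ 2) ≤ y (σ 1) := hσ (by decide)
  have h23 : y (σ 3) ≤ y (σ 2) := hσ (by decide)
  have h3 := hy.1 (σ 3)
  -- Abel summation: the drop after the `k`-th sorted coordinate multiplies the indicator of the
  -- first `k` indices, which is `k/ℓ` times the vertex. The slack in `∑ yᵢ ≤ ℓ` is the weight of
  -- the origin.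
  let w : Fin 5 → ℝ := ![(ℓ - (y (σ 0) + y (σ 1) + y (σ 2) + y (σ 3))) / ℓ,
    (y (σ 0) - y (σ 1)) / ℓ, 2 * (y (σ 1) - y (σ 2)) / ℓ, 3 * (y (σ 2) - y (σ 3)) / ℓ,
    4 * y (σ 3) / ℓ]
  let S : Fin 5 → Finset (Fin 4) := ![∅, {0}, {0, 1}, {0, 1, 2}, {0, 1, 2, 3}]
  have hw : ∀ k, 0 ≤ w k := by
    intro k
    fin_cases k <;> refine div_nonneg ?_ hℓ.le <;> linarith
  have hw1 : ∑ k, w k = 1 := by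
    simp [w, Fin.sum_univ_succ]
    field_simp
    ring
  have hS : ∀ k, S k ∈ sortedSupports := by decide
  have hcomb : ∑ k, w k • cornerVertex ℓ ((S k).map σ.toEmbedding) = y := by
    ext i
    obtain ⟨j, rfl⟩ := σ.surjective i
    have hmem : ∀ k, σ j ∈ (S k).map σ.toEmbedding ↔ j ∈ S k := fun k => by simp
    simp only [WithLp.ofLp_sum, Finset.sum_apply, PiLp.smul_apply, cornerVertex_apply, hmem,
      Finset.card_map, smul_eq_mul]
    have hcard : ∀ k : Fin 5, (S k).card = k := by decide
    simp only [hcard]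
    fin_cases j <;> simp [S, w, Fin.sum_univ_succ] <;> field_simp <;> ring
  rw [← hcomb]
  exact (convex_convexHull ℝ _).sum_mem (fun k _ => hw k) hw1 fun k _ => hC _ (hS k)

/-- Coordinates can be sorted in decreasing order. -/
theorem exists_antitone_comp_perm {n : ℕ} (f : Fin n → ℝ) :
    ∃ σ : Equiv.Perm (Fin n), Antitone fun i => f (σ i) :=
  ⟨Tuple.sort fun i => -f i, fun _ _ hij =>
    neg_le_neg_iff.1 (Tuple.monotone_sort (fun i => -f i) hij)⟩

/-- With ties, sorting may put another maximal index first; swapping it with `0` changes no values.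
-/
theorem exists_antitone_comp_perm_fixing_zero {f : Fin 4 → ℝ} (hf : ∀ i, f i ≤ f 0) :
    ∃ σ : Equiv.Perm (Fin 4), σ 0 = 0 ∧ Antitone fun i => f (σ i) := by
  obtain ⟨σ, hσ⟩ := exists_antitone_comp_perm f
  have h0 : f (σ 0) = f 0 := by
    refine le_antisymm (hf _) ?_
    simpa using hσ (Fin.zero_le (σ.symm 0))
  have hswap : ∀ i, f (Equiv.swap (σ 0) 0 i) = f i := by
    intro i
    rcases eq_or_ne i (σ 0) with rfl | h1
    · rw [Equiv.swap_apply_left, h0]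
    · rcases eq_or_ne i 0 with rfl | h2
      · rw [Equiv.swap_apply_right, h0]
      · rw [Equiv.swap_apply_of_ne_of_ne h1 h2]
  refine ⟨Equiv.swap (σ 0) 0 * σ, by simp, ?_⟩
  simpa [hswap] using hσ

/-! ### Convex hulls and extreme points of the slices -/

theorem cornerSortedSlice_eq_convexHull {ℓ : ℝ} (hℓ : 0 < ℓ) :
    cornerSortedSlice ℓ = convexHull ℝ (cornerVertex ℓ '' (sortedSupports : Set _)) := by
  refine Set.Subset.antisymm (fun y hy => ?_) (convexHull_min ?_ (convex_cornerSortedSlice ℓ))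
  · have h1 : ∀ S : Finset (Fin 4), S.map (1 : Equiv.Perm (Fin 4)).toEmbedding = S :=
      fun S => Finset.map_refl
    simpa [h1] using mem_convexHull_of_antitone hℓ hy.1 1 (by simpa using hy.2)
  · rintro _ ⟨S, hS, rfl⟩
    exact cornerVertex_mem_cornerSortedSlice hℓ hS

theorem cornerMaxSlice_subset_convexHull {ℓ : ℝ} (hℓ : 0 < ℓ) :
    cornerMaxSlice ℓ ⊆ convexHull ℝ (cornerVertex ℓ '' (maxSupports : Set _)) := by
  intro y hy
  obtain ⟨σ, h0, hσ⟩ := exists_antitone_comp_perm_fixing_zero hy.2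
  refine convexHull_mono (Set.image_mono ?_) (mem_convexHull_of_antitone hℓ hy.1 σ hσ)
  intro T hT
  obtain ⟨S, hS, rfl⟩ := Finset.mem_image.1 (Finset.mem_coe.1 hT)
  have h := (Finset.mem_filter.1 (sortedSupports_subset hS)).2
  refine Finset.mem_coe.2 (Finset.mem_filter.2 ⟨Finset.mem_univ _, ?_⟩)
  rcases h with rfl | h
  · simp
  · exact Or.inr (Finset.mem_map.2 ⟨0, h, h0⟩)

theorem cornerMaxSlice_eq_convexHull {ℓ : ℝ} (hℓ : 0 < ℓ) :
    cornerMaxSlice ℓ = convexHull ℝ (cornerVertex ℓ '' (maxSupports : Set _)) := by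
  refine Set.Subset.antisymm (cornerMaxSlice_subset_convexHull hℓ)
    (convexHull_min ?_ (convex_cornerMaxSlice ℓ))
  rintro _ ⟨S, hS, rfl⟩
  exact cornerVertex_mem_cornerMaxSlice hℓ hS

/-- The unique maximizer of a linear functional is an extreme point. -/
theorem mem_extremePoints_of_forall_le {E : Type*} [AddCommGroup E] [Module ℝ E] {A : Set E}
    {x : E} (hx : x ∈ A) (f : E →ₗ[ℝ] ℝ) (hf : ∀ y ∈ A, f y ≤ f x)
    (huniq : ∀ y ∈ A, f y = f x → y = x) : x ∈ A.extremePoints ℝ := by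
  refine mem_extremePoints_iff_left.2 ⟨hx, fun y hy z hz h => huniq y hy ?_⟩
  obtain ⟨a, b, ha, hb, hab, rfl⟩ := h
  have h1 := hf y hy
  have h2 := hf z hz
  simp only [map_add, map_smul, smul_eq_mul] at h1 h2 ⊢
  have e1 : a = 1 - b := by linarith
  subst e1
  have h3 : 0 ≤ b * (f z - f y) := by linarith
  have h4 : (1 - b) * (f z - f y) ≤ 0 := by linarith
  have h5 : f z - f y = 0 :=
    le_antisymm (nonpos_of_mul_nonpos_right h4 ha) (nonneg_of_mul_nonneg_right h3 hb)
  linear_combination (-b) * h5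

/-- Add up defining inequalities that are tight at the vertex: a point maximizing the resulting
functional makes each of them tight, and they have a single common solution. -/
theorem cornerVertex_mem_extremePoints {ℓ : ℝ} (hℓ : 0 < ℓ) {S : Finset (Fin 4)}
    (hS : S ∈ maxSupports) : cornerVertex ℓ S ∈ (cornerMaxSlice ℓ).extremePoints ℝ := by
  let p : Fin 4 → EuclideanSpace ℝ (Fin 4) →ₗ[ℝ] ℝ := fun i => (EuclideanSpace.proj i).toLinearMap
  have hp : ∀ i y, p i y = y i := fun _ _ => rfl
  have hK := cornerVertex_mem_cornerMaxSlice hℓ hS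
  rcases (Finset.mem_filter.1 hS).2 with rfl | h
  · have h0 : cornerVertex ℓ ∅ = 0 := by ext; simp
    refine mem_extremePoints_of_forall_le hK (-∑ i, p i) ?_ ?_
    · intro y hy
      have : 0 ≤ ∑ i, y i := Finset.sum_nonneg fun i _ => hy.1.1 i
      simpa [h0, hp] using this
    · intro y hy h
      have h1 : ∑ i, y i = 0 := by simpa [h0, hp] using h
      rw [Finset.sum_eq_zero_iff_of_nonneg fun i _ => hy.1.1 i] at h1
      ext i
      simp [h1 i]
  · have hc : (S.card : ℝ) ≠ 0 := Nat.cast_ne_zero.2 (Finset.card_ne_zero_of_mem h)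
    let f : EuclideanSpace ℝ (Fin 4) →ₗ[ℝ] ℝ :=
      ∑ i, p i - (∑ i ∈ Sᶜ, p i + ∑ i ∈ S, (p 0 - p i))
    have hf : ∀ y, f y = ∑ i, y i - (∑ i ∈ Sᶜ, y i + ∑ i ∈ S, (y 0 - y i)) := fun y => by
      simp [f, hp]
    have hfx : f (cornerVertex ℓ S) = ℓ := by
      have h1 : ∑ i ∈ Sᶜ, cornerVertex ℓ S i = 0 :=
        Finset.sum_eq_zero fun i hi => by simp [Finset.mem_compl.1 hi]
      have h2 : ∑ i ∈ S, (cornerVertex ℓ S 0 - cornerVertex ℓ S i) = 0 :=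
        Finset.sum_eq_zero fun i hi => by simp [h, hi]
      rw [hf, h1, h2]
      simp [Finset.sum_ite_mem, mul_div_cancel₀ ℓ hc]
    have hn1 : ∀ y ∈ cornerMaxSlice ℓ, ∀ i ∈ Sᶜ, 0 ≤ y i := fun y hy i _ => hy.1.1 i
    have hn2 : ∀ y ∈ cornerMaxSlice ℓ, ∀ i ∈ S, 0 ≤ y 0 - y i := fun y hy i _ =>
      sub_nonneg.2 (hy.2 i)
    refine mem_extremePoints_of_forall_le hK f ?_ ?_
    · intro y hy
      rw [hf, hfx]
      have := Finset.sum_nonneg (hn1 y hy)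
      have := Finset.sum_nonneg (hn2 y hy)
      have := hy.1.2
      linarith
    · intro y hy hfy
      rw [hf, hfx] at hfy
      have h1 := Finset.sum_nonneg (hn1 y hy)
      have h2 := Finset.sum_nonneg (hn2 y hy)
      have h3 := hy.1.2
      have e1 := (Finset.sum_eq_zero_iff_of_nonneg (hn1 y hy)).1 (by linarith)
      have e2 := (Finset.sum_eq_zero_iff_of_nonneg (hn2 y hy)).1 (by linarith)
      have e3 : ∑ i, y i = ℓ := by linarith
      have e4 : ∀ i, y i = if i ∈ S then y 0 else 0 := fun i => by
        split_ifs with hi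
        · linarith [e2 i hi]
        · exact e1 i (Finset.mem_compl.2 hi)
      have e5 : (S.card : ℝ) * y 0 = ℓ := by
        rw [← e3, Finset.sum_congr rfl fun i _ => e4 i]
        simp [Finset.sum_ite_mem]
      ext i
      rw [e4 i, cornerVertex_apply, ← e5, mul_div_cancel_left₀ _ hc]

theorem extremePoints_cornerMaxSlice {ℓ : ℝ} (hℓ : 0 < ℓ) :
    (cornerMaxSlice ℓ).extremePoints ℝ = cornerVertex ℓ '' (maxSupports : Set _) := by
  refine Set.Subset.antisymm ?_ ?_
  · rw [cornerMaxSlice_eq_convexHull hℓ]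
    exact extremePoints_convexHull_subset
  · rintro _ ⟨S, hS, rfl⟩
    exact cornerVertex_mem_extremePoints hℓ hS

/-- Extremality in the larger slice passes to the smaller one, so no new functionals are needed. -/
theorem extremePoints_cornerSortedSlice {ℓ : ℝ} (hℓ : 0 < ℓ) :
    (cornerSortedSlice ℓ).extremePoints ℝ = cornerVertex ℓ '' (sortedSupports : Set _) := by
  refine Set.Subset.antisymm ?_ ?_
  · rw [cornerSortedSlice_eq_convexHull hℓ]
    exact extremePoints_convexHull_subset
  · rintro _ ⟨S, hS, rfl⟩
    exact inter_extremePoints_subset_extremePoints_of_subset (cornerSortedSlice_subset ℓ)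
      ⟨cornerVertex_mem_cornerSortedSlice hℓ hS,
        cornerVertex_mem_extremePoints hℓ (sortedSupports_subset hS)⟩

theorem extremePoints_cornerMaxSlice_inter {ℓ : ℝ} (hℓ : 0 < ℓ) :
    (cornerSortedSlice ℓ).extremePoints ℝ =
      (cornerMaxSlice ℓ).extremePoints ℝ ∩ cornerSortedSlice ℓ := by
  refine Set.Subset.antisymm (fun y hy => ⟨?_, hy.1⟩) fun y hy =>
    inter_extremePoints_subset_extremePoints_of_subset (cornerSortedSlice_subset ℓ)
      ⟨hy.2, hy.1⟩
  rw [extremePoints_cornerMaxSlice hℓ]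
  rw [extremePoints_cornerSortedSlice hℓ] at hy
  exact Set.image_mono (Finset.coe_subset.2 sortedSupports_subset) hy

theorem interior_setOf_apply_eq {κ : Type*} [Fintype κ] [DecidableEq κ] {i j : κ} (hij : i ≠ j) :
    interior {y : EuclideanSpace ℝ κ | y i = y j} = ∅ := by
  by_contra hne
  have := Submodule.eq_top_of_nonempty_interior'
    (LinearMap.ker ((EuclideanSpace.proj i : EuclideanSpace ℝ κ →L[ℝ] ℝ) -
      EuclideanSpace.proj j).toLinearMap) (by
      convert Set.nonempty_iff_ne_empty.2 hne using 2
      ext y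
      simp [sub_eq_zero])
  have h1 : EuclideanSpace.single i (1 : ℝ) ∈ (⊤ : Submodule ℝ (EuclideanSpace ℝ κ)) := trivial
  rw [← this] at h1
  simp [hij.symm] at h1

/-- The sorted slice is a fundamental polytope for the symmetries of the corner simplex. -/
theorem isFundPolytopeOn_cornerSortedSlice {ℓ : ℝ} (hℓ : 0 < ℓ) :
    IsFundPolytopeOn (rigidSymmetryGroup (cornerSimplex (Fin 4) ℓ)) (cornerSimplex (Fin 4) ℓ)
      (cornerSortedSlice ℓ) where
  left :=
    { subset := fun _ hy => hy.1
      isClosed := isClosed_cornerSortedSlice ℓ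
      isConnected := (convex_cornerSortedSlice ℓ).isConnected
        ⟨_, cornerVertex_mem_cornerSortedSlice hℓ (S := ∅) (by decide)⟩
      exists_mem := fun y hy => by
        obtain ⟨σ, hσ⟩ := exists_antitone_comp_perm fun i => y i
        exact ⟨permCoords σ.symm, permCoords_mem_rigidSymmetryGroup _ ℓ,
          permCoords_mem_cornerSimplex _ hy, by simpa using hσ⟩
      interior_eq_empty := fun g hg hne => by
        obtain ⟨σ, rfl⟩ := exists_eq_permCoords hℓ hg
        obtain ⟨i, hi⟩ : ∃ i, σ i ≠ i := by
          by_contra! h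
          exact hne (by rw [Equiv.ext (f := σ) (g := 1) h, permCoords_one])
        refine Set.subset_eq_empty (interior_mono ?_) (interior_setOf_apply_eq hi)
        rintro _ ⟨⟨y, hy, rfl⟩, hy'⟩
        -- A decreasing rearrangement is unique, so `y` and its permuted copy coincide; the overlap
        -- lies in the hyperplane where coordinates `σ i` and `i` agree.
        have h := congrFun (Tuple.unique_antitone (f := fun i => y i) (σ := 1) (τ := σ.symm)
          (by simpa [Function.comp_def] using hy.2)
          (by simpa [Function.comp_def] using hy'.2))
        simpa using h i }
  right := ⟨sortedSupports.image (cornerVertex ℓ), by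
    rw [Finset.coe_image, cornerSortedSlice_eq_convexHull hℓ]⟩

end CornerSlices

/-! ### Transport along affine isometries -/

section Transport

variable {V W : Type*} [NormedAddCommGroup V] [InnerProductSpace ℝ V]
  [NormedAddCommGroup W] [InnerProductSpace ℝ W] (φ : V ≃ᵃⁱ[ℝ] W)

theorem AffineIsometryEquiv.preimage_extremePoints (X : Set W) :
    (φ ⁻¹' X).extremePoints ℝ = φ ⁻¹' X.extremePoints ℝ := by
  have himg : ∀ x y, φ '' openSegment ℝ x y = openSegment ℝ (φ x) (φ y) := fun x y =>
    image_openSegment ℝ φ.toAffineEquiv.toAffineMap x y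
  ext a
  simp only [Set.mem_preimage, mem_extremePoints, φ.surjective.forall, ← himg,
    φ.injective.mem_set_image, φ.injective.eq_iff]

/-- Conjugation by an affine isometry. -/
noncomputable def AffineIsometryEquiv.conjMulEquiv : (V ≃ᵃⁱ[ℝ] V) ≃* (W ≃ᵃⁱ[ℝ] W) where
  toFun g := φ.symm.trans (g.trans φ)
  invFun g := φ.trans (g.trans φ.symm)
  left_inv g := by ext; simp
  right_inv g := by ext; simp
  map_mul' g h := by ext; simp [AffineIsometryEquiv.coe_mul]

theorem AffineIsometryEquiv.conjMulEquiv_apply (g : V ≃ᵃⁱ[ℝ] V) (x : V) :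
    φ.conjMulEquiv g (φ x) = φ (g x) := by
  simp [AffineIsometryEquiv.conjMulEquiv]

theorem AffineIsometryEquiv.preimage_conjMulEquiv_image (g : V ≃ᵃⁱ[ℝ] V) (X : Set W) :
    φ ⁻¹' (φ.conjMulEquiv g '' X) = g '' (φ ⁻¹' X) := by
  ext x
  constructor
  · rintro ⟨y, hy, h⟩
    obtain ⟨z, rfl⟩ := φ.surjective y
    rw [conjMulEquiv_apply] at h
    exact ⟨z, hy, φ.injective h⟩
  · rintro ⟨z, hz, rfl⟩
    exact ⟨φ z, hz, conjMulEquiv_apply φ g z⟩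

theorem AffineIsometryEquiv.conjMulEquiv_mem_iff (g : V ≃ᵃⁱ[ℝ] V) (X : Set W) :
    φ.conjMulEquiv g ∈ rigidSymmetryGroup X ↔ g ∈ rigidSymmetryGroup (φ ⁻¹' X) := by
  change φ.conjMulEquiv g '' X = X ↔ g '' (φ ⁻¹' X) = φ ⁻¹' X
  rw [← preimage_conjMulEquiv_image, φ.surjective.preimage_injective.eq_iff]

theorem AffineIsometryEquiv.map_rigidSymmetryGroup (X : Set W) :
    (rigidSymmetryGroup (φ ⁻¹' X)).map φ.conjMulEquiv.toMonoidHom = rigidSymmetryGroup X := by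
  ext g
  constructor
  · rintro ⟨h, hh, rfl⟩
    exact (conjMulEquiv_mem_iff φ h X).2 hh
  · intro hg
    obtain ⟨h, rfl⟩ := φ.conjMulEquiv.surjective g
    exact ⟨h, (conjMulEquiv_mem_iff φ h X).1 hg, rfl⟩

/-- Isometric sets have isomorphic symmetry groups. -/
noncomputable def AffineIsometryEquiv.rigidSymmetryGroupEquiv (X : Set W) :
    rigidSymmetryGroup (φ ⁻¹' X) ≃* rigidSymmetryGroup X :=
  (φ.conjMulEquiv.subgroupMap _).trans (MulEquiv.subgroupCongr (φ.map_rigidSymmetryGroup X))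

theorem IsFundDomainOn.preimage {X F : Set W} (h : IsFundDomainOn (rigidSymmetryGroup X) X F) :
    IsFundDomainOn (rigidSymmetryGroup (φ ⁻¹' X)) (φ ⁻¹' X) (φ ⁻¹' F) where
  subset := Set.preimage_mono h.subset
  isClosed := h.isClosed.preimage φ.continuous
  isConnected := by
    have : φ ⁻¹' F = φ.symm '' F := by
      ext x
      constructor
      · exact fun hx => ⟨φ x, hx, by simp⟩
      · rintro ⟨y, hy, rfl⟩
        simpa using hy
    rw [this]
    exact h.isConnected.image _ φ.symm.continuous.continuousOn
  exists_mem x hx := by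
    obtain ⟨g, hg, hgx⟩ := h.exists_mem (φ x) hx
    obtain ⟨g, rfl⟩ := φ.conjMulEquiv.surjective g
    rw [AffineIsometryEquiv.conjMulEquiv_apply] at hgx
    exact ⟨g, (φ.conjMulEquiv_mem_iff g X).1 hg, hgx⟩
  interior_eq_empty g hg hne := by
    have h1 := h.interior_eq_empty _ ((φ.conjMulEquiv_mem_iff g X).2 hg)
      (by simpa using hne)
    have h2 := φ.toHomeomorph.preimage_interior (φ.conjMulEquiv g '' F ∩ F)
    rw [h1, AffineIsometryEquiv.coe_toHomeomorph, Set.preimage_inter,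
      φ.preimage_conjMulEquiv_image] at h2
    simpa using h2.symm

theorem IsConvexPolytope.preimage {F : Set W} (h : IsConvexPolytope F) :
    IsConvexPolytope (φ ⁻¹' F) := by
  classical
  obtain ⟨s, rfl⟩ := h
  refine ⟨s.image φ.symm, ?_⟩
  have h1 := φ.symm.toAffineEquiv.toAffineMap.image_convexHull (s : Set W)
  have h2 : φ ⁻¹' (convexHull ℝ (s : Set W)) = φ.symm '' (convexHull ℝ (s : Set W)) := by
    ext x
    constructor
    · exact fun hx => ⟨φ x, hx, by simp⟩
    · rintro ⟨y, hy, rfl⟩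
      simpa using hy
  rw [h2, Finset.coe_image]
  exact h1

end Transport

/-! ### The highest root of a Euclidean root system of type `D₄` -/

namespace RootPairing

variable {ι V : Type*} [NormedAddCommGroup V] [InnerProductSpace ℝ V] {P : RootPairing ι ℝ V V}

theorem IsEuclidean.pairing_eq (hP : P.IsEuclidean) (i j : ι) :
    P.pairing i j = 2 * ⟪P.root i, P.root j⟫ / ⟪P.root j, P.root j⟫ := by
  rw [← root_coroot_eq_pairing, hP.pairing_eq_inner, hP.coroot_eq, real_inner_smul_right]
  ring

theorem IsEuclidean.inner_root_self_pos (hP : P.IsEuclidean) (i : ι) :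
    0 < ⟪P.root i, P.root i⟫ := by
  refine lt_of_le_of_ne real_inner_self_nonneg fun h => ?_
  have h1 := hP.pairing_eq i i
  rw [P.pairing_same, ← h] at h1
  norm_num at h1

theorem IsEuclidean.two_mul_inner (hP : P.IsEuclidean) (i j : ι) :
    2 * ⟪P.root i, P.root j⟫ = P.pairing i j * ⟪P.root j, P.root j⟫ := by
  rw [hP.pairing_eq, div_mul_cancel₀ _ (hP.inner_root_self_pos j).ne']

theorem IsEuclidean.root_reflectionPerm_eq (hP : P.IsEuclidean) (i j : ι) :
    P.root (P.reflectionPerm j i) =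
      P.root i - (2 * ⟪P.root i, P.root j⟫ / ⟪P.root j, P.root j⟫) • P.root j := by
  rw [root_reflectionPerm, reflection_apply_root, hP.pairing_eq]

theorem IsEuclidean.inner_reflectionPerm_self (hP : P.IsEuclidean) (i j : ι) :
    ⟪P.root (P.reflectionPerm j i), P.root (P.reflectionPerm j i)⟫ = ⟪P.root i, P.root i⟫ := by
  have h := (hP.inner_root_self_pos j).ne'
  rw [hP.root_reflectionPerm_eq]
  simp only [inner_sub_left, inner_sub_right, real_inner_smul_left, real_inner_smul_right,
    real_inner_comm (P.root i) (P.root j)]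
  field_simp
  ring

namespace Base

theorem repr_nonneg_of_mem_closure [P.IsRootSystem] (b : P.Base) {x : V}
    (hx : x ∈ AddSubmonoid.closure (P.root '' b.support)) (k : b.support) :
    0 ≤ b.toWeightBasis.repr x k := by
  classical
  induction hx using AddSubmonoid.closure_induction with
  | mem x hx =>
    obtain ⟨i, hi, rfl⟩ := hx
    rw [b.toWeightBasis_repr_root ⟨i, hi⟩, Finsupp.single_apply]
    split_ifs <;> norm_num
  | zero => simp
  | add x y _ _ hx hy => simpa using add_nonneg hx hy

theorem IsHighestRoot.eq [P.IsRootSystem] {b : P.Base} {θ θ' : V} (h : b.IsHighestRoot θ)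
    (h' : b.IsHighestRoot θ') : θ = θ' := by
  obtain ⟨⟨i, rfl⟩, h1⟩ := h
  obtain ⟨⟨j, rfl⟩, h2⟩ := h'
  refine b.toWeightBasis.ext_elem fun k => le_antisymm ?_ ?_
  · simpa using b.repr_nonneg_of_mem_closure (h2 i) k
  · simpa using b.repr_nonneg_of_mem_closure (h1 j) k

/-- By uniqueness, exhibiting one highest root identifies the one picked by `Classical.epsilon`. -/
theorem IsHighestRoot.highestRoot_eq [P.IsRootSystem] {b : P.Base} {θ : V}
    (h : b.IsHighestRoot θ) : b.highestRoot = θ :=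
  IsHighestRoot.eq (Classical.epsilon_spec ⟨θ, h⟩) h

theorem exists_root_eq_sum_fin (b : P.Base) (e : Fin 4 ≃ b.support) (i : ι) :
    ∃ n : Fin 4 → ℤ, P.root i = ∑ k, (n k : ℝ) • P.root (e k) := by
  obtain ⟨f, -, -, hf⟩ := b.exists_root_eq_sum_int i
  refine ⟨fun k => f (e k), ?_⟩
  rw [hf, Equiv.sum_comp e fun j : b.support => (f j : ℝ) • P.root j,
    Finset.sum_coe_sort b.support fun j => (f j : ℝ) • P.root j]
  exact Finset.sum_congr rfl fun j _ => (Int.cast_smul_eq_zsmul ℝ _ _).symm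

section TypeD4

variable [P.IsCrystallographic] {b : P.Base} {e : Fin 4 ≃ b.support}

theorem IsTypeD4.pairing_eq (hD : b.IsTypeD4 e) (i j : Fin 4) :
    P.pairing (e i) (e j) = (CartanMatrix.D 4 i j : ℝ) := by
  rw [← hD i j, ← algebraMap_cartanMatrixIn_apply (S := ℤ)]
  simp

/-- Each outer node is joined to the centre by a simple bond: both pairings are `-1`, which forces
equal lengths. -/
theorem IsTypeD4.inner_root_self (hP : P.IsEuclidean) (hD : b.IsTypeD4 e) (i : Fin 4) :
    ⟪P.root (e i), P.root (e i)⟫ = ⟪P.root (e 1), P.root (e 1)⟫ := by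
  rcases eq_or_ne i 1 with rfl | hi
  · rfl
  have hC : ∀ i : Fin 4, i ≠ 1 → CartanMatrix.D 4 i 1 = -1 ∧ CartanMatrix.D 4 1 i = -1 := by
    decide
  have h1 := hP.two_mul_inner (e i) (e 1)
  have h2 := hP.two_mul_inner (e 1) (e i)
  rw [hD.pairing_eq, (hC i hi).1] at h1
  rw [hD.pairing_eq, (hC i hi).2, real_inner_comm] at h2
  push_cast at h1 h2
  linarith

theorem IsTypeD4.inner_root_root (hP : P.IsEuclidean) (hD : b.IsTypeD4 e) (i j : Fin 4) :
    ⟪P.root (e i), P.root (e j)⟫ =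
      CartanMatrix.D 4 i j / 2 * ⟪P.root (e 1), P.root (e 1)⟫ := by
  have h1 := hP.two_mul_inner (e i) (e j)
  rw [hD.pairing_eq, hD.inner_root_self hP] at h1
  linarith

theorem IsTypeD4.inner_root_self_of_any [Finite ι] [P.IsReduced] (hP : P.IsEuclidean)
    (hD : b.IsTypeD4 e) (i : ι) :
    ⟪P.root i, P.root i⟫ = ⟪P.root (e 1), P.root (e 1)⟫ := by
  refine b.induction_reflect i (p := fun i => ⟪P.root i, P.root i⟫ = ⟪P.root (e 1), P.root (e 1)⟫)
    (fun i hi => ?_) (fun i hi => ?_) (fun i j hi _ => ?_)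
  · rwa [hP.inner_reflectionPerm_self]
  · obtain ⟨k, hk⟩ := e.surjective ⟨i, hi⟩
    have := hD.inner_root_self hP k
    rwa [hk] at this
  · rwa [hP.inner_reflectionPerm_self]

/-- The coordinates of a vector of norm `2` in the `D₄` lattice are at most `1, 2, 1, 1`. -/
theorem d4_coeff_le {n : Fin 4 → ℤ}
    (h : n 0 ^ 2 + n 1 ^ 2 + n 2 ^ 2 + n 3 ^ 2 - n 1 * (n 0 + n 2 + n 3) = 1) :
    n 0 ≤ 1 ∧ n 1 ≤ 2 ∧ n 2 ≤ 1 ∧ n 3 ≤ 1 := by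
  -- Four times the hypothesis, with the squares completed in the outer variables.
  have hq : (2 * n 0 - n 1) ^ 2 + (2 * n 2 - n 1) ^ 2 + (2 * n 3 - n 1) ^ 2 + n 1 ^ 2 = 4 := by
    linarith
  have h0 := sq_nonneg (2 * n 0 - n 1)
  have h2 := sq_nonneg (2 * n 2 - n 1)
  have h3 := sq_nonneg (2 * n 3 - n 1)
  have h1 : n 1 ≤ 2 := by nlinarith
  have h1' : -2 ≤ n 1 := by nlinarith
  -- Two numbers with sum `2m` have squares adding up to at least `2m²`, which is at least `8` once
  -- `m ≥ 2`.
  have aux : ∀ m : ℤ, (2 * m - n 1) ^ 2 + n 1 ^ 2 ≤ 4 → m ≤ 1 := by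
    intro m hm
    by_contra! hlt
    nlinarith [sq_nonneg (2 * m - n 1 - n 1)]
  exact ⟨aux _ (by linarith), h1, aux _ (by linarith), aux _ (by linarith)⟩

/-- Reflecting `α₂` in `α₁, α₃, α₄` and again in `α₂` adds one simple root each time, so the
candidate is a root. It dominates because all roots have the same length, so their integer
coordinates solve the quadratic equation of `d4_coeff_le`. -/
theorem IsTypeD4.isHighestRoot [Finite ι] [P.IsReduced] (hP : P.IsEuclidean)
    (hD : b.IsTypeD4 e) :
    b.IsHighestRoot
      (P.root (e 0) + (2 : ℝ) • P.root (e 1) + P.root (e 2) + P.root (e 3)) := by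
  have hin := hD.inner_root_root hP
  have hc := hP.inner_root_self_pos (e 1)
  set c := ⟪P.root (e 1), P.root (e 1)⟫ with hcdef
  refine ⟨?_, fun i => ?_⟩
  · have step : ∀ x y (j : Fin 4), x ∈ Set.range P.root →
        x - (2 * ⟪x, P.root (e j)⟫ / c) • P.root (e j) = y → y ∈ Set.range P.root := by
      rintro _ _ j ⟨i, rfl⟩ rfl
      refine ⟨P.reflectionPerm (e j) i, ?_⟩
      rw [hP.root_reflectionPerm_eq, hD.inner_root_self hP j]
    have r0 : P.root (e 1) + P.root (e 0) ∈ Set.range P.root := by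
      refine step _ _ 0 ⟨e 1, rfl⟩ ?_
      rw [hin, show 2 * ((CartanMatrix.D 4 1 0 : ℤ) / 2 * c) / c = -1 by
        simp [CartanMatrix.D]; field_simp]
      module
    have r2 : P.root (e 1) + P.root (e 0) + P.root (e 2) ∈ Set.range P.root := by
      refine step _ _ 2 r0 ?_
      simp only [inner_add_left, hin]
      rw [show 2 * ((CartanMatrix.D 4 1 2 : ℤ) / 2 * c + (CartanMatrix.D 4 0 2 : ℤ) / 2 * c) / c
        = -1 by simp [CartanMatrix.D]; field_simp]
      module
    have r3 : P.root (e 1) + P.root (e 0) + P.root (e 2) + P.root (e 3) ∈ Set.range P.root := by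
      refine step _ _ 3 r2 ?_
      simp only [inner_add_left, hin]
      rw [show 2 * ((CartanMatrix.D 4 1 3 : ℤ) / 2 * c + (CartanMatrix.D 4 0 3 : ℤ) / 2 * c
        + (CartanMatrix.D 4 2 3 : ℤ) / 2 * c) / c = -1 by simp [CartanMatrix.D]; field_simp]
      module
    refine step _ _ 1 r3 ?_
    simp only [inner_add_left, hin]
    rw [show 2 * ((CartanMatrix.D 4 1 1 : ℤ) / 2 * c + (CartanMatrix.D 4 0 1 : ℤ) / 2 * c
        + (CartanMatrix.D 4 2 1 : ℤ) / 2 * c + (CartanMatrix.D 4 3 1 : ℤ) / 2 * c) / c = -1 by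
      simp [CartanMatrix.D]; field_simp; norm_num]
    module
  · obtain ⟨n, hn⟩ := exists_root_eq_sum_fin b e i
    have hnorm := hD.inner_root_self_of_any hP i
    rw [hn, ← hcdef] at hnorm
    simp only [Fin.sum_univ_four, inner_add_left, inner_add_right, real_inner_smul_left,
      real_inner_smul_right, hin] at hnorm
    simp [CartanMatrix.D] at hnorm
    have hq : ((n 0 : ℝ) ^ 2 + n 1 ^ 2 + n 2 ^ 2 + n 3 ^ 2 - n 1 * (n 0 + n 2 + n 3)) = 1 := by
      refine mul_right_cancel₀ hc.ne' ?_
      linarith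
    obtain ⟨h0, h1, h2, h3⟩ := d4_coeff_le (n := n) (by exact_mod_cast hq)
    have hmem : ∀ (m : ℤ) (k : Fin 4), 0 ≤ m →
        (m : ℝ) • P.root (e k) ∈ AddSubmonoid.closure (P.root '' b.support) := by
      intro m k hm
      obtain ⟨a, rfl⟩ := Int.eq_ofNat_of_zero_le hm
      have : P.root (e k) ∈ AddSubmonoid.closure (P.root '' b.support) :=
        AddSubmonoid.subset_closure ⟨e k, (e k).2, rfl⟩
      simpa [Nat.cast_smul_eq_nsmul] using nsmul_mem this a
    have hsub : P.root (e 0) + (2 : ℝ) • P.root (e 1) + P.root (e 2) + P.root (e 3) - P.root i =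
        ((1 - n 0 : ℤ) : ℝ) • P.root (e 0) + ((2 - n 1 : ℤ) : ℝ) • P.root (e 1) +
        ((1 - n 2 : ℤ) : ℝ) • P.root (e 2) + ((1 - n 3 : ℤ) : ℝ) • P.root (e 3) := by
      rw [hn, Fin.sum_univ_four]
      push_cast
      module
    rw [hsub]
    exact add_mem (add_mem (add_mem (hmem _ _ (by lia)) (hmem _ _ (by lia)))
      (hmem _ _ (by lia))) (hmem _ _ (by lia))

theorem IsTypeD4.highestRoot_eq [Finite ι] [P.IsReduced] [P.IsRootSystem] (hP : P.IsEuclidean)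
    (hD : b.IsTypeD4 e) :
    b.highestRoot = P.root (e 0) + (2 : ℝ) • P.root (e 1) + P.root (e 2) + P.root (e 3) :=
  (hD.isHighestRoot hP).highestRoot_eq

theorem IsTypeD4.isMinuscule_iff [Finite ι] [P.IsReduced] [P.IsRootSystem] (hP : P.IsEuclidean)
    (hD : b.IsTypeD4 e) (j : Fin 4) : b.IsMinuscule (e j) ↔ j ≠ 1 := by
  rw [IsMinuscule, mark, hD.highestRoot_eq hP]
  simp only [map_add, map_smul, toWeightBasis_repr_root, Finsupp.add_apply, Finsupp.smul_apply]
  fin_cases j <;> simp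

end TypeD4

end Base

end RootPairing

theorem Fin.forall_fin_four {p : Fin 4 → Prop} : (∀ i, p i) ↔ p 0 ∧ p 1 ∧ p 2 ∧ p 3 := by
  simp [Fin.forall_fin_succ]

theorem Fin.antitone_four_iff {f : Fin 4 → ℝ} :
    Antitone f ↔ f 1 ≤ f 0 ∧ f 2 ≤ f 1 ∧ f 3 ≤ f 2 := by
  simp [Fin.antitone_iff_succ_le, Fin.forall_fin_succ]

/-! ### The fundamental alcove of type `D₄` as a corner simplex -/

namespace RootPairing.Base

theorem inner_root_fundCoweight {ι V : Type*} [NormedAddCommGroup V] [InnerProductSpace ℝ V]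
    [FiniteDimensional ℝ V] {P : RootPairing ι ℝ V V} [P.IsRootSystem] (b : P.Base)
    (e : Fin 4 ≃ b.support) (i j : Fin 4) :
    ⟪P.root (e i), b.fundCoweight (e j)⟫ = if i = j then 1 else 0 := by
  classical
  rw [real_inner_comm, inner_fundCoweight_root]
  simp [eq_comm]

variable {ι V : Type*} [Finite ι] [NormedAddCommGroup V] [InnerProductSpace ℝ V]
  [FiniteDimensional ℝ V] {P : RootPairing ι ℝ V V} [P.IsRootSystem] [P.IsCrystallographic]
  [P.IsReduced] {b : P.Base} {e : Fin 4 ≃ b.support}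

/-- The highest root and the simple roots at the ends of the Dynkin diagram are orthogonal, and
give Cartesian coordinates in which the alcove is a corner simplex. -/
theorem IsTypeD4.exists_coordinates (hP : P.IsEuclidean) (hD : b.IsTypeD4 e) :
    ∃ (φ : V ≃ᵃⁱ[ℝ] EuclideanSpace ℝ (Fin 4)) (ℓ : ℝ), 0 < ℓ ∧ ∀ x,
      φ x 0 = ℓ * (1 - ⟪b.highestRoot, x⟫) ∧ φ x 1 = ℓ * ⟪P.root (e 0), x⟫ ∧
      φ x 2 = ℓ * ⟪P.root (e 2), x⟫ ∧ φ x 3 = ℓ * ⟪P.root (e 3), x⟫ := by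
  have hin := hD.inner_root_root hP
  have hc := hP.inner_root_self_pos (e 1)
  have hθ := hD.highestRoot_eq hP
  set c := ⟪P.root (e 1), P.root (e 1)⟫
  let v : Fin 4 → V := ![-b.highestRoot, P.root (e 0), P.root (e 2), P.root (e 3)]
  have hv : ∀ i j, ⟪v i, v j⟫ = if i = j then c else 0 := by
    intro i j
    fin_cases i <;> fin_cases j <;>
      simp [v, hθ, inner_add_left, inner_add_right, real_inner_smul_left, real_inner_smul_right,
        hin, CartanMatrix.D, -inner_self_eq_norm_sq_to_K] <;> ring
  have hs : 0 < √c := Real.sqrt_pos.2 hc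
  have hss : √c * √c = c := Real.mul_self_sqrt hc.le
  have hon : Orthonormal ℝ fun i => (√c)⁻¹ • v i := by
    rw [orthonormal_iff_ite]
    intro i j
    rw [real_inner_smul_left, real_inner_smul_right, hv]
    split_ifs
    · field_simp
      rw [sq, hss]
    · simp
  have hrank : Fintype.card (Fin 4) = Module.finrank ℝ V := by
    rw [Module.finrank_eq_card_basis b.toWeightBasis, Fintype.card_congr e]
  let B := basisOfOrthonormalOfCardEqFinrank hon hrank
  have hB : ⇑B = fun i => (√c)⁻¹ • v i := coe_basisOfOrthonormalOfCardEqFinrank hon hrank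
  let o := B.toOrthonormalBasis (by rwa [hB])
  have ho : ∀ i, o i = (√c)⁻¹ • v i := fun i => by simp [o, hB]
  -- The new origin: here `α₁, α₃, α₄` vanish and `α₀` equals `1`, because its coefficient at `α₂`
  -- is `2`.
  let q : V := (1 / 2 : ℝ) • b.fundCoweight (e 1)
  let φ := (AffineIsometryEquiv.constVAdd ℝ V (-q)).trans o.repr.toAffineIsometryEquiv
  have hφ : ∀ x i, φ x i = (√c)⁻¹ * (⟪v i, x⟫ - ⟪v i, q⟫) := by
    intro x i
    have : φ x i = ⟪o i, -q + x⟫ := by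
      rw [← o.repr_apply_apply]
      rfl
    rw [this, ho, real_inner_smul_left, inner_add_right, inner_neg_right]
    ring
  refine ⟨φ, (√c)⁻¹, inv_pos.2 hs, fun x => ?_⟩
  refine ⟨?_, ?_, ?_, ?_⟩ <;> rw [hφ] <;>
    simp [v, q, hθ, inner_add_left, real_inner_smul_left, real_inner_smul_right,
      inner_root_fundCoweight]
  exact Or.inl (by ring)

end RootPairing.Base

/-! ### The main theorem, read off in coordinates -/

theorem mainTheorem10 {ι V : Type*} [Finite ι] [NormedAddCommGroup V] [InnerProductSpace ℝ V]
    [FiniteDimensional ℝ V] (P : RootPairing ι ℝ V V) [P.IsRootSystem] [P.IsCrystallographic]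
    [P.IsReduced] (hP : P.IsEuclidean) (b : P.Base) (e : Fin 4 ≃ b.support)
    (hD : b.IsTypeD4 e)
    (α ϖ : Fin 4 → V) (hα : ∀ i, α i = P.root (e i)) (hϖ : ∀ i, ϖ i = b.fundCoweight (e i))
    (K L : Set V) (hK : K = b.komrakovPremet)
    (hL : L = b.slicedPolytope (α 2 - α 3) (α 0 - α 2)) :
    IsFundPolytopeOn (rigidSymmetryGroup b.alcove) b.alcove L ∧
    Nonempty (rigidSymmetryGroup b.alcove ≃* Equiv.Perm (Fin 4)) ∧
    polytopeVertices L = polytopeVertices K ∩ L ∧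
    polytopeVertices L = polytopeVertices K \
      {(1 / 2 : ℝ) • ϖ 2, (1 / 2 : ℝ) • ϖ 3,
        (1 / 3 : ℝ) • (ϖ 0 + ϖ 3), (1 / 3 : ℝ) • (ϖ 2 + ϖ 3)} ∧
    polytopeVertices L =
      {0, (1 / 2 : ℝ) • ϖ 0, (1 / 2 : ℝ) • ϖ 1, (1 / 3 : ℝ) • (ϖ 0 + ϖ 2),
        (1 / 4 : ℝ) • (ϖ 0 + ϖ 2 + ϖ 3)} ∧
    (polytopeVertices K).Finite ∧
    (polytopeVertices L).ncard + 4 = (polytopeVertices K).ncard := by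
  obtain ⟨φ, ℓ, hℓ, hφ⟩ := hD.exists_coordinates hP
  have hθ := hD.highestRoot_eq hP
  have h0 x := (hφ x).1
  have h1 x := (hφ x).2.1
  have h2 x := (hφ x).2.2.1
  have h3 x := (hφ x).2.2.2
  have hmin := hD.isMinuscule_iff hP
  have hθx : ∀ x, ⟪b.highestRoot, x⟫ = ⟪P.root (e 0), x⟫ + 2 * ⟪P.root (e 1), x⟫ +
      ⟪P.root (e 2), x⟫ + ⟪P.root (e 3), x⟫ := fun x => by
    rw [hθ, inner_add_left, inner_add_left, inner_add_left, real_inner_smul_left]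
  -- This turns the remaining wall `(α₂, x) ≥ 0` into the bound `∑ yᵢ ≤ ℓ`.
  have hsum : ∀ x, ℓ * (1 - ⟪b.highestRoot, x⟫) + ℓ * ⟪P.root (e 0), x⟫ +
      ℓ * ⟪P.root (e 2), x⟫ + ℓ * ⟪P.root (e 3), x⟫ = ℓ - 2 * (ℓ * ⟪P.root (e 1), x⟫) :=
    fun x => by rw [hθx]; ring
  have hle : ∀ a a' : ℝ, ℓ * a ≤ ℓ * a' ↔ a ≤ a' := fun a a' => mul_le_mul_iff_right₀ hℓ
  have hA : b.alcove = φ ⁻¹' cornerSimplex (Fin 4) ℓ := by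
    ext x
    simp only [RootPairing.Base.alcove, cornerSimplex, Set.mem_ofPred_eq,
      Set.mem_preimage, ← e.forall_congr_right,
      Fin.forall_fin_four, Fin.sum_univ_four, h0, h1, h2, h3, mul_nonneg_iff_of_pos_left hℓ,
      sub_nonneg, hsum]
    have := mul_nonneg_iff_of_pos_left hℓ (b := ⟪P.root (e 1), x⟫)
    constructor
    · rintro ⟨⟨a0, a1, a2, a3⟩, a⟩
      exact ⟨⟨a, a0, a2, a3⟩, by linarith [this.2 a1]⟩
    · rintro ⟨⟨a, a0, a2, a3⟩, a1⟩
      exact ⟨⟨a0, this.1 (by linarith), a2, a3⟩, a⟩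
  have hK' : K = φ ⁻¹' cornerMaxSlice ℓ := by
    rw [hK]
    ext x
    simp only [RootPairing.Base.komrakovPremet, cornerMaxSlice, hA, Set.mem_ofPred_eq, Set.mem_preimage,
      ← e.forall_congr_right, hmin, Fin.forall_fin_four, h0, h1, h2, h3, hle, inner_add_left]
    refine and_congr_right fun _ => ?_
    simp [le_sub_iff_add_le']
  have hL' : L = φ ⁻¹' cornerSortedSlice ℓ := by
    rw [hL]
    ext x
    simp only [RootPairing.Base.slicedPolytope, ← hK, hK', cornerMaxSlice,
      cornerSortedSlice, Set.mem_ofPred_eq,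
      Set.mem_preimage, hα, Fin.antitone_four_iff, Fin.forall_fin_four, h0, h1, h2, h3, hle,
      inner_sub_left, sub_nonneg]
    constructor
    · rintro ⟨⟨hx, -, a1, -, -⟩, a3, a2⟩
      exact ⟨hx, a1, a2, a3⟩
    · rintro ⟨hx, a1, a2, a3⟩
      exact ⟨⟨hx, le_rfl, a1, a2.trans a1, (a3.trans a2).trans a1⟩, a3, a2⟩
  let ψ : Finset (Fin 4) → V := fun S => φ.symm (cornerVertex ℓ S)
  have hψinj : Function.Injective ψ := φ.symm.injective.comp (cornerVertex_injective hℓ)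
  have hψ : ∀ T : Set (Finset (Fin 4)), φ ⁻¹' (cornerVertex ℓ '' T) = ψ '' T := fun T => by
    rw [← Set.image_image φ.symm]
    exact (φ.symm.toEquiv.image_eq_preimage_symm _).symm
  have hinner : ∀ i j, ⟪P.root (e i), ϖ j⟫ = if i = j then 1 else 0 := fun i j => by
    rw [hϖ, RootPairing.Base.inner_root_fundCoweight]
  -- The four coordinates determine a point, so each listed coweight combination is matched with its
  -- support `S` by evaluating four roots.
  have hψeq : ∀ S x, 1 - ⟪b.highestRoot, x⟫ = (if (0 : Fin 4) ∈ S then (1 / S.card : ℝ) else 0) ∧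
      ⟪P.root (e 0), x⟫ = (if (1 : Fin 4) ∈ S then (1 / S.card : ℝ) else 0) ∧
      ⟪P.root (e 2), x⟫ = (if (2 : Fin 4) ∈ S then (1 / S.card : ℝ) else 0) ∧
      ⟪P.root (e 3), x⟫ = (if (3 : Fin 4) ∈ S then (1 / S.card : ℝ) else 0) → ψ S = x := by
    rintro S x ⟨e0, e1, e2, e3⟩
    refine φ.injective ((φ.apply_symm_apply _).trans ?_)
    ext i
    rw [cornerVertex_apply]
    fin_cases i
    · exact ((h0 x).trans (by rw [e0, mul_ite, mul_one_div, mul_zero]; rfl)).symm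
    · exact ((h1 x).trans (by rw [e1, mul_ite, mul_one_div, mul_zero]; rfl)).symm
    · exact ((h2 x).trans (by rw [e2, mul_ite, mul_one_div, mul_zero]; rfl)).symm
    · exact ((h3 x).trans (by rw [e3, mul_ite, mul_one_div, mul_zero]; rfl)).symm
  have hvK : polytopeVertices K = ψ '' (maxSupports : Set _) := by
    rw [hK', polytopeVertices, φ.preimage_extremePoints, extremePoints_cornerMaxSlice hℓ, hψ]
  have hvL : polytopeVertices L = ψ '' (sortedSupports : Set _) := by
    rw [hL', polytopeVertices, φ.preimage_extremePoints, extremePoints_cornerSortedSlice hℓ, hψ]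
  refine ⟨?_, ?_, ?_, ?_, ?_, ?_, ?_⟩
  · rw [hA, hL']
    have h := isFundPolytopeOn_cornerSortedSlice hℓ
    exact ⟨h.1.preimage φ, h.2.preimage φ⟩
  · rw [hA]
    exact ⟨(φ.rigidSymmetryGroupEquiv _).trans
      (MulEquiv.ofBijective _ (permCoordsHom_bijective hℓ)).symm⟩
  · rw [hK', hL']
    simp only [polytopeVertices, φ.preimage_extremePoints,
      extremePoints_cornerMaxSlice_inter hℓ, Set.preimage_inter]
  · have h : ({(1 / 2 : ℝ) • ϖ 2, (1 / 2 : ℝ) • ϖ 3, (1 / 3 : ℝ) • (ϖ 0 + ϖ 3),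
        (1 / 3 : ℝ) • (ϖ 2 + ϖ 3)} : Set V) =
        ψ '' (({{0, 2}, {0, 3}, {0, 1, 3}, {0, 2, 3}} : Finset (Finset (Fin 4))) : Set _) := by
      simp only [Finset.coe_insert, Finset.coe_singleton, Set.image_insert_eq, Set.image_singleton]
      rw [hψeq {0, 2} ((1 / 2 : ℝ) • ϖ 2), hψeq {0, 3} ((1 / 2 : ℝ) • ϖ 3),
        hψeq {0, 1, 3} ((1 / 3 : ℝ) • (ϖ 0 + ϖ 3)), hψeq {0, 2, 3} ((1 / 3 : ℝ) • (ϖ 2 + ϖ 3))] <;>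
      simp [hθx, hinner, inner_add_right, real_inner_smul_right] <;> norm_num
    rw [h, hvL, hvK, ← Set.image_sdiff hψinj, ← Finset.coe_sdiff]
    congr 2
  · rw [hvL, sortedSupports]
    simp only [Finset.coe_insert, Finset.coe_singleton, Set.image_insert_eq, Set.image_singleton]
    -- The empty support is the corner `ϖ^∨₂/2`; the zero vector of `V` has support `{0}`, because
    -- `1 - (α₀, 0) = 1`.
    rw [hψeq ∅ ((1 / 2 : ℝ) • ϖ 1), hψeq {0} 0, hψeq {0, 1} ((1 / 2 : ℝ) • ϖ 0),
      hψeq {0, 1, 2} ((1 / 3 : ℝ) • (ϖ 0 + ϖ 2)),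
      hψeq {0, 1, 2, 3} ((1 / 4 : ℝ) • (ϖ 0 + ϖ 2 + ϖ 3))]
    · rw [Set.insert_comm, Set.insert_comm ((1 / 2 : ℝ) • ϖ 1)]
    all_goals simp [hθx, hinner, inner_add_right, real_inner_smul_right] <;> norm_num
  · rw [hvK]
    exact (Finset.finite_toSet _).image _
  · rw [hvK, hvL, Set.ncard_image_of_injective _ hψinj, Set.ncard_image_of_injective _ hψinj,
      Set.ncard_coe_finset, Set.ncard_coe_finset]
    decide
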